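/- Let $T$ be a finite tree with at least two vertices. Definitions. For a finite graph $G$ and $S\subseteq V(G)$ put $\overline S=V(G)\setminus S$. The set $S$ is a super dominating set if for every $u\in\overline S$ there is $v\in S$ with $N(v)\cap\overline S=\{u\}$; such a $v$ is called an external private neighbor of $u$. The super domination number $\gamma_{sp}(G)$ is the minimum cardinality of a super dominating set, and a super dominating set of this cardinality is a $\gamma_{sp}(G)$-set. The super domination subdivision number $sd_{\gamma_{sp}}(G)$ is the minimum number of edges of $G$ that must be subdivided (each edge at most once) in order to increase $\gamma_{sp}$. The tree $T$ is in Class 1 if $sd_{\gamma_{sp}}(T)=1$ and in Class 2 if $sd_{\gamma_{sp}}(T)=2$. For a super dominating set $S$, let $U_S(G)$ be the set of all $v$ such that, for some $u\in\overline S$, $v$ is the only external private neighbor of $u$. Let $\mathscr U$ be the family of trees obtained, up to isomorphism, from a star of order at least three by a finite (possibly empty) sequence of the following operation: take a vertex $v$ of the current tree $T'$ such that some $\gamma_{sp}(T')$-set $S$ satisfies either $N_{T'}[v]\cap\overline S=\emptyset$, or $v\notin\overline S$ and $N_{T'}[v]\cap U_S(T')=\emptyset$; add a new star of order at least two and join its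 center to $v$ (either vertex of a star of order two may serve as its center). Theorem 3.5. $T$ is in Class 1 if and only if $T\notin\mathscr U$. Moreover, if $T$ is not a star $K_{1,m}$ with $m\ge 3$, then $T$ is in Class 1 or in Class 2, and $T$ is in Class 2 if and only if $T\in\mathscr U$. If $T$ is a star $K_{1,m}$ with $m\ge 3$, then $sd_{\gamma_{sp}}(T)=m$. -/

import Mathlib

universe u

namespace SuperDom

variable {V : Type u}

/-- `S` is a super dominating set of `G`: every vertex `w` outside `S` has some `v ∈ S`
with `N(v) ∩ (V ∖ S) = {w}`. -/
def IsSuperDominating (G : SimpleGraph V) (S : Set V) : Prop :=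
  ∀ w ∈ Sᶜ, ∃ v ∈ S, G.neighborSet v ∩ Sᶜ = {w}

/-- The super domination number of a (finite) graph: the least cardinality of a super
dominating set. -/
noncomputable def superDominationNumber (G : SimpleGraph V) : ℕ :=
  sInf {k : ℕ | ∃ S : Set V, IsSuperDominating G S ∧ S.ncard = k}

/-- `S` is a super dominating set of minimum cardinality. -/
def IsMinSuperDominating (G : SimpleGraph V) (S : Set V) : Prop :=
  IsSuperDominating G S ∧ S.ncard = superDominationNumber G

/-- `v` is an external private neighbor of `w` with respect to the complement of `S`. -/
def IsExtPrivateNeighbor (G : SimpleGraph V) (S : Set V) (w v : V) : Prop :=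
  w ∈ Sᶜ ∧ v ∈ S ∧ G.neighborSet v ∩ Sᶜ = {w}

/-- The set `Q_S(G)`: vertices outside `S` with exactly one external private neighbor. -/
def QSet (G : SimpleGraph V) (S : Set V) : Set V :=
  {w | w ∈ Sᶜ ∧ ∃! v, IsExtPrivateNeighbor G S w v}

/-- The set `U_S(G)`: the unique external private neighbors of the vertices of `Q_S(G)`. -/
def USet (G : SimpleGraph V) (S : Set V) : Set V :=
  {v | ∃ w ∈ QSet G S, IsExtPrivateNeighbor G S w v}

/-- The graph obtained from `G` by subdividing once each edge in `F` (a set of edges of `G`);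
the new vertex on the edge `e ∈ F` is `Sum.inr e`. -/
def subdivide (G : SimpleGraph V) (F : Set (Sym2 V)) : SimpleGraph (V ⊕ F) where
  Adj x y :=
    match x, y with
    | .inl a, .inl b => G.Adj a b ∧ s(a, b) ∉ F
    | .inl a, .inr e => a ∈ e.1
    | .inr e, .inl a => a ∈ e.1
    | .inr _, .inr _ => False
  symm := ⟨by
    rintro (a | e) (b | f) h
    · exact ⟨h.1.symm, by rw [Sym2.eq_swap]; exact h.2⟩
    · exact h
    · exact h
    · exact h⟩
  loopless := ⟨by
    rintro (a | e) h
    · exact h.1.ne rfl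
    · exact h⟩

/-- The super domination subdivision number of a (finite) graph: the least number of edges
that must be subdivided (each at most once) to increase the super domination number. -/
noncomputable def superDomSubdivisionNumber (G : SimpleGraph V) : ℕ :=
  sInf {k : ℕ | ∃ F : Set (Sym2 V), F ⊆ G.edgeSet ∧ F.ncard = k ∧
    superDominationNumber G < superDominationNumber (subdivide G F)}

/-- `T` is in Class 1. -/
def IsClass1 (T : SimpleGraph V) : Prop := superDomSubdivisionNumber T = 1

/-- `T` is in Class 2. -/
def IsClass2 (T : SimpleGraph V) : Prop := superDomSubdivisionNumber T = 2

/-- Add to `G` a new star with `m` leaves (center `0 : Fin (m + 1)`) and join its center to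
the vertex `v` of `G`. -/
def attachStar (G : SimpleGraph V) (v : V) (m : ℕ) : SimpleGraph (V ⊕ Fin (m + 1)) :=
  (G ⊕g SimpleGraph.starGraph (0 : Fin (m + 1))) ⊔ SimpleGraph.edge (Sum.inl v) (Sum.inr 0)

/-- The condition on the vertex `v` of `G` under which a star may be attached at `v`. The closed
neighborhood `N[v]` is `insert v (G.neighborSet v)`. -/
def Attachable (G : SimpleGraph V) (v : V) : Prop :=
  ∃ S : Set V, IsMinSuperDominating G S ∧
    (insert v (G.neighborSet v) ∩ Sᶜ = ∅ ∨
      (v ∉ Sᶜ ∧ insert v (G.neighborSet v) ∩ USet G S = ∅))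

/-- The family `𝒰`: graphs obtained (up to isomorphism) from a star of order at least three by
finitely many times attaching, by its center, a star of order at least two to an
attachable vertex. -/
inductive FamilyU : ∀ {V : Type u}, SimpleGraph V → Prop
  | star {V : Type u} (G : SimpleGraph V) (m : ℕ) (hm : 2 ≤ m)
      (e : G ≃g SimpleGraph.starGraph (0 : Fin (m + 1))) : FamilyU G
  | attach {V W : Type u} (G' : SimpleGraph V) (G : SimpleGraph W) (h : FamilyU G')
      (v : V) (hv : Attachable G' v) (m : ℕ) (hm : 1 ≤ m)
      (e : G ≃g attachStar G' v m) : FamilyU G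

end SuperDom

/-!
Write `D` for the complement of a super dominating set, so that every vertex of `D` has a private
neighbor outside `D`, and let `a(G)` be the largest size of such a `D` (`superDominatedNumber`).
Since `γ_sp(G) + a(G)` is the number of vertices, subdividing the edges in `F` raises `γ_sp` if and
only if `a` grows by less than `|F|`. In particular a tree is in Class 1 if and only if it is not
*stable* (`IsStable`), stability meaning that `a` grows whenever a single edge is subdivided.

Everything follows from how `a` behaves when a star is joined by its center `c` to a vertex `v` of a
graph `G` (`IsStarExtension`). If the star has a leaf, then `a` grows by exactly one
(`IsStarExtension.superDominatedNumber_eq`). If the star is the single vertex `c`, then `a` grows by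
at most one, and for acyclic `G` it grows precisely when `v` is attachable
(`IsStarExtension.superDominatedNumber_eq_iff`). Let `H` be `G` with a star with at least one leaf
joined to `v`. Subdividing an edge of `G` commutes with attaching the star. Subdividing the new edge
at `v` gives a star attached to a pendant vertex at `v`. Subdividing an edge of the star gives a
star of order two attached to `c`, where `c` is now the center of a smaller star, possibly a single
vertex, joined to `v`. So `H` is stable if and only if `G` is stable and `v` is attachable
(`IsStarExtension.isStable_iff`).

A star of order at least three arises in this way from a single vertex, so by induction the members
of `𝒰` are stable. Conversely, in a tree with at least three vertices the parent of a vertex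
farthest from a suitable root is the center of such a star (`exists_isStarExtension_induce`), so a
stable tree with at least two vertices is in `𝒰`, the tree with two vertices not being stable.

For the number of edges needed, `a(G)` is at most the size of any vertex cover
(`superDominatedNumber_le_of_cover`). This yields two edges whose subdivision raises `γ_sp` for `P₃`
and for a star attached to a star with at least three leaves. Such a pair of edges survives the
attachment of further stars (`FamilyU.exists_two_edges`). For a star itself, the cover by the
subdivision vertices shows that subdividing all edges raises `γ_sp`, while
`le_superDominatedNumber_subdivide_starGraph` shows that subdividing fewer does not.
-/

namespace SuperDom

open SimpleGraph

/-! ### Super dominated sets -/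

/-- A set `D` is super dominated if its complement is a super dominating set: every `w ∈ D` has a
private neighbor `v ∉ D`, that is, one whose only neighbor in `D` is `w`. -/
def IsSuperDominated {V : Type*} (G : SimpleGraph V) (D : Set V) : Prop :=
  ∀ w ∈ D, ∃ v, v ∉ D ∧ G.Adj v w ∧ ∀ x ∈ D, G.Adj v x → x = w

/-- The largest cardinality of a super dominated set. -/
noncomputable def superDominatedNumber {V : Type*} (G : SimpleGraph V) : ℕ :=
  sSup {k : ℕ | ∃ D : Set V, IsSuperDominated G D ∧ D.ncard = k}

section Dual

variable {V : Type*} {G : SimpleGraph V}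

lemma neighborSet_inter_eq_singleton_iff {D : Set V} {v w : V} (hw : w ∈ D) :
    G.neighborSet v ∩ D = {w} ↔ G.Adj v w ∧ ∀ x ∈ D, G.Adj v x → x = w := by
  constructor
  · intro h
    have h1 : w ∈ G.neighborSet v ∩ D := by rw [h]; rfl
    refine ⟨h1.1, fun x hx hvx => ?_⟩
    have h2 : x ∈ G.neighborSet v ∩ D := ⟨hvx, hx⟩
    rw [h] at h2
    exact h2
  · rintro ⟨h1, h2⟩
    ext x
    constructor
    · rintro ⟨hx, hxD⟩
      exact h2 x hxD hx
    · rintro rfl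
      exact ⟨h1, hw⟩

lemma isSuperDominating_iff {S : Set V} : IsSuperDominating G S ↔ IsSuperDominated G Sᶜ := by
  refine forall₂_congr fun w hw => exists_congr fun v => ?_
  rw [neighborSet_inter_eq_singleton_iff hw, Set.notMem_compl_iff]

lemma isSuperDominated_empty : IsSuperDominated G ∅ := fun w hw => absurd hw (Set.notMem_empty w)

variable [Finite V]

lemma IsSuperDominated.ncard_le {D : Set V} (hD : IsSuperDominated G D) :
    D.ncard ≤ superDominatedNumber G :=
  le_csSup ⟨Nat.card V, by rintro _ ⟨D, -, rfl⟩; exact Set.ncard_le_card D⟩ ⟨D, hD, rfl⟩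

lemma exists_isSuperDominated_ncard_eq (G : SimpleGraph V) :
    ∃ D, IsSuperDominated G D ∧ D.ncard = superDominatedNumber G :=
  Nat.sSup_mem (s := {k : ℕ | ∃ D : Set V, IsSuperDominated G D ∧ D.ncard = k})
    ⟨0, ∅, isSuperDominated_empty, by simp⟩
    ⟨Nat.card V, by rintro _ ⟨D, -, rfl⟩; exact Set.ncard_le_card D⟩

lemma superDominationNumber_add (G : SimpleGraph V) :
    superDominationNumber G + superDominatedNumber G = Nat.card V := by
  obtain ⟨D, hD, hDc⟩ := exists_isSuperDominated_ncard_eq G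
  have hle : superDominationNumber G ≤ Dᶜ.ncard :=
    Nat.sInf_le ⟨Dᶜ, isSuperDominating_iff.2 (by rwa [compl_compl]), rfl⟩
  obtain ⟨S, hS, hSc⟩ := Nat.sInf_mem
    (s := {k : ℕ | ∃ S : Set V, IsSuperDominating G S ∧ S.ncard = k})
    ⟨_, Dᶜ, isSuperDominating_iff.2 (by rwa [compl_compl]), rfl⟩
  have h1 := (isSuperDominating_iff.1 hS).ncard_le
  have h2 := Set.ncard_add_ncard_compl S
  have h3 := Set.ncard_add_ncard_compl D
  change S.ncard = superDominationNumber G at hSc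
  omega

lemma isMinSuperDominating_iff {S : Set V} :
    IsMinSuperDominating G S ↔
      IsSuperDominated G Sᶜ ∧ Sᶜ.ncard = superDominatedNumber G := by
  have h1 := superDominationNumber_add G
  have h2 := Set.ncard_add_ncard_compl S
  rw [IsMinSuperDominating, isSuperDominating_iff]
  refine and_congr_right fun _ => ?_
  omega

/-- Each vertex of a vertex cover lies in at most one of the disjoint edges joining the vertices of
a super dominated set to their private neighbors. -/
lemma superDominatedNumber_le_of_cover (C : Set V) (hC : ∀ x y, G.Adj x y → x ∈ C ∨ y ∈ C) :
    superDominatedNumber G ≤ C.ncard := by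
  classical
  obtain ⟨D, hD, hDc⟩ := exists_isSuperDominated_ncard_eq G
  rw [← hDc]
  choose! p hp using hD
  refine Set.ncard_le_ncard_of_injOn (fun w => if w ∈ C then w else p w) ?_ ?_
  · intro w hw
    by_cases h : w ∈ C
    · simp [h]
    · simpa [h] using (hC _ _ (hp w hw).2.1).resolve_right h
  · intro w hw x hx hwx
    by_cases h : w ∈ C <;> by_cases h' : x ∈ C <;> simp only [h, h', if_true, if_false] at hwx
    · exact hwx
    · exact absurd (hwx ▸ hw) (hp x hx).1
    · exact absurd (hwx ▸ hx) (hp w hw).1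
    · exact ((hp w hw).2.2 x hx (hwx ▸ (hp x hx).2.1)).symm

end Dual

section Attachable

variable {V : Type*} {G : SimpleGraph V}

lemma eq_of_adj_of_isAcyclic {a b c d : V} (hG : G.IsAcyclic) (hac : a ≠ c)
    (hab : G.Adj a b) (hbc : G.Adj b c) (had : G.Adj a d) (hdc : G.Adj d c) : b = d := by
  have h := (hG.subsingleton_path a c).elim
    ⟨.cons hab (.cons hbc .nil), by simp [hab.ne, hac, hbc.ne]⟩
    ⟨.cons had (.cons hdc .nil), by simp [had.ne, hac, hdc.ne]⟩
  simpa using congrArg Walk.snd (congrArg Subtype.val h)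

lemma not_adj_of_isAcyclic {a b c : V} (hG : G.IsAcyclic)
    (hab : G.Adj a b) (hbc : G.Adj b c) : ¬ G.Adj a c := by
  intro hac
  have h := (hG.subsingleton_path a c).elim
    ⟨.cons hab (.cons hbc .nil), by simp [hab.ne, hac.ne, hbc.ne]⟩
    ⟨.cons hac .nil, by simp [hac.ne]⟩
  simpa using congrArg Walk.length (congrArg Subtype.val h)

/-- In an acyclic graph two private neighbors of the same vertex cannot both lie in `N[v]` when
`v ∉ D`, so the condition on `U_S(G)` says that every vertex of `D` has a private neighbor
outside `N[v]`. -/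
lemma attachable_iff [Finite V] (hG : G.IsAcyclic) {v : V} :
    Attachable G v ↔ ∃ D, IsSuperDominated G D ∧ D.ncard = superDominatedNumber G ∧ v ∉ D ∧
      ((∀ x ∈ D, ¬ G.Adj v x) ∨
        ∀ w ∈ D, ∃ p, p ∉ D ∧ p ≠ v ∧ ¬ G.Adj v p ∧ G.Adj p w ∧ ∀ x ∈ D, G.Adj p x → x = w) := by
  constructor
  · rintro ⟨S, hS, h⟩
    rw [isMinSuperDominating_iff] at hS
    refine ⟨Sᶜ, hS.1, hS.2, ?_⟩
    rcases h with h | ⟨hv, h⟩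
    · rw [Set.eq_empty_iff_forall_notMem] at h
      exact ⟨fun hv => h v ⟨Set.mem_insert _ _, hv⟩,
        .inl fun x hx hvx => h x ⟨Set.mem_insert_of_mem _ hvx, hx⟩⟩
    · rw [Set.eq_empty_iff_forall_notMem] at h
      refine ⟨hv, .inr fun w hw => ?_⟩
      by_contra! hcon
      have key : ∀ p, IsExtPrivateNeighbor G S w p → p = v ∨ G.Adj v p := by
        rintro p ⟨-, hpS, hp⟩
        rw [neighborSet_inter_eq_singleton_iff hw] at hp
        by_contra! hpv
        obtain ⟨x, hx, hpx, hxw⟩ := hcon p (by simpa using hpS) hpv.1 hpv.2 hp.1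
        exact hxw (hp.2 x hx hpx)
      obtain ⟨p, hpS, hp⟩ := isSuperDominating_iff.2 hS.1 w hw
      have hpw : IsExtPrivateNeighbor G S w p := ⟨hw, hpS, hp⟩
      refine h p ⟨key p hpw, w, ⟨hw, p, hpw, fun q hqw => ?_⟩, hpw⟩
      have hpa := ((neighborSet_inter_eq_singleton_iff hw).1 hpw.2.2).1
      have hqa := ((neighborSet_inter_eq_singleton_iff hw).1 hqw.2.2).1
      rcases key p hpw with rfl | hvp <;> rcases key q hqw with rfl | hvq
      · rfl
      · exact absurd hpa (not_adj_of_isAcyclic hG hvq hqa)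
      · exact absurd hqa (not_adj_of_isAcyclic hG hvp hpa)
      · exact eq_of_adj_of_isAcyclic hG (fun hvw : v = w => hv (hvw ▸ hw)) hvq hqa hvp hpa
  · rintro ⟨D, hD, hDc, hv, h⟩
    refine ⟨Dᶜ, isMinSuperDominating_iff.2 (by rw [compl_compl]; exact ⟨hD, hDc⟩), ?_⟩
    rw [compl_compl]
    rcases h with h | h
    · left
      rw [Set.eq_empty_iff_forall_notMem]
      rintro x ⟨rfl | hx, hxD⟩
      · exact hv hxD
      · exact h x hxD hx
    · right
      refine ⟨hv, ?_⟩
      rw [Set.eq_empty_iff_forall_notMem]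
      rintro q ⟨hqv, w, ⟨hw, hu⟩, hq⟩
      rw [compl_compl] at hw
      obtain ⟨p, hpD, hpv, hvp, hpw, hp⟩ := h w hw
      have : p = q := hu.unique
        ⟨by rwa [compl_compl], hpD, by
          rw [compl_compl, neighborSet_inter_eq_singleton_iff hw]; exact ⟨hpw, hp⟩⟩ hq
      subst this
      exact hqv.elim hpv hvp

end Attachable

/-! ### Attaching a star -/

/-- The graph `H` arises from a copy of `G`, embedded by `f`, by adding a vertex `c` joined to
`f v`, together with any number of leaves (possibly none) adjacent to `c`. -/
structure IsStarExtension {V W : Type*} (G : SimpleGraph V) (H : SimpleGraph W) (f : V → W)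
    (v : V) (c : W) : Prop where
  injective : Function.Injective f
  adj_iff : ∀ a b, H.Adj (f a) (f b) ↔ G.Adj a b
  ne_center : ∀ a, f a ≠ c
  center_adj_iff : ∀ a, H.Adj c (f a) ↔ a = v
  leaf_adj_iff : ∀ w, w ≠ c → (∀ a, f a ≠ w) → ∀ x, H.Adj w x ↔ x = c

namespace IsStarExtension

variable {V W : Type*} {G : SimpleGraph V} {H : SimpleGraph W} {f : V → W} {v : V} {c : W}

lemma finite [Finite W] (h : IsStarExtension G H f v c) : Finite V :=
  Finite.of_injective f h.injective

lemma center_or_image_or_leaf (w : W) : w = c ∨ (∃ a, f a = w) ∨ (w ≠ c ∧ ∀ a, f a ≠ w) := by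
  by_cases h : w = c
  · exact .inl h
  · by_cases h' : ∃ a, f a = w
    · exact .inr (.inl h')
    · exact .inr (.inr ⟨h, fun a ha => h' ⟨a, ha⟩⟩)

lemma ncard_le [Finite W] (h : IsStarExtension G H f v c) {D : Set W} {E : Set V} (x : W)
    (hD : D ⊆ insert x (f '' E)) : D.ncard ≤ E.ncard + 1 :=
  calc D.ncard ≤ (insert x (f '' E)).ncard := Set.ncard_le_ncard hD
    _ ≤ (f '' E).ncard + 1 := Set.ncard_insert_le _ _
    _ = E.ncard + 1 := by rw [Set.ncard_image_of_injective _ h.injective]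

lemma ncard_insert [Finite W] (h : IsStarExtension G H f v c) (E : Set V) {x : W}
    (hx : x ∉ f '' E) : (insert x (f '' E)).ncard = E.ncard + 1 := by
  rw [Set.ncard_insert_of_notMem hx, Set.ncard_image_of_injective _ h.injective]

/-- A vertex of a super dominated set can lose its private neighbor in the copy of `G` only if
it is `v` and its private neighbor is `c`. -/
lemma exists_private (h : IsStarExtension G H f v c) {D : Set W} (hD : IsSuperDominated H D)
    {w : V} (hw : f w ∈ D) (hwv : c ∉ D → w ≠ v) :
    ∃ p, f p ∉ D ∧ G.Adj p w ∧ ∀ x, f x ∈ D → G.Adj p x → x = w := by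
  obtain ⟨p, hpD, hpw, hp⟩ := hD _ hw
  rcases center_or_image_or_leaf (f := f) (c := c) p with rfl | ⟨b, rfl⟩ | ⟨h1, h2⟩
  · exact absurd ((h.center_adj_iff w).1 hpw) (hwv hpD)
  · exact ⟨b, hpD, (h.adj_iff _ _).1 hpw,
      fun x hx hbx => h.injective (hp _ hx ((h.adj_iff _ _).2 hbx))⟩
  · exact absurd ((h.leaf_adj_iff p h1 h2 _).1 hpw) (h.ne_center w)

lemma isSuperDominated_preimage_diff (h : IsStarExtension G H f v c) {D : Set W}
    (hD : IsSuperDominated H D) : IsSuperDominated G (f ⁻¹' D \ {v}) := by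
  rintro w ⟨hw, hwv⟩
  obtain ⟨p, hpD, hpw, hp⟩ := h.exists_private hD hw fun _ => hwv
  exact ⟨p, fun hp' => hpD hp'.1, hpw, fun x hx => hp x hx.1⟩

lemma isSuperDominated_preimage (h : IsStarExtension G H f v c) {D : Set W}
    (hD : IsSuperDominated H D) (hcv : c ∉ D → f v ∉ D) : IsSuperDominated G (f ⁻¹' D) := by
  intro w hw
  exact h.exists_private hD hw fun hc hwv => hcv hc (hwv ▸ hw)

lemma eq_center_of_leaf_mem (h : IsStarExtension G H f v c) {D : Set W}
    (hD : IsSuperDominated H D) {w : W} (hwD : w ∈ D) (h1 : w ≠ c) (h2 : ∀ a, f a ≠ w) :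
    c ∉ D ∧ ∀ x ∈ D, H.Adj c x → x = w := by
  obtain ⟨p, hpD, hpw, hp⟩ := hD w hwD
  obtain rfl := (h.leaf_adj_iff w h1 h2 p).1 hpw.symm
  exact ⟨hpD, hp⟩

lemma superDominatedNumber_le [Finite W] (h : IsStarExtension G H f v c) :
    superDominatedNumber H ≤ superDominatedNumber G + 1 := by
  have := h.finite
  obtain ⟨D, hD, hDc⟩ := exists_isSuperDominated_ncard_eq H
  rw [← hDc]
  by_cases hsub : ∀ w ∈ D, ∃ a, f a = w
  · have hE := h.isSuperDominated_preimage_diff hD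
    refine (h.ncard_le (f v) fun w hw => ?_).trans (Nat.add_le_add_right hE.ncard_le 1)
    obtain ⟨a, rfl⟩ := hsub w hw
    by_cases hav : a = v
    · exact .inl (hav ▸ rfl)
    · exact .inr ⟨a, ⟨hw, hav⟩, rfl⟩
  · push Not at hsub
    obtain ⟨z, hz, hzf⟩ := hsub
    have key : ∀ w ∈ D, (∀ a, f a ≠ w) → w = z := by
      intro w hw hwf
      by_cases hwc : w = c
      · by_contra hwz
        exact (h.eq_center_of_leaf_mem hD hz (fun hzc => hwz (hwc.trans hzc.symm)) hzf).1
          (hwc ▸ hw)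
      · obtain ⟨hcD, huniq⟩ := h.eq_center_of_leaf_mem hD hw hwc hwf
        exact (huniq z hz ((h.leaf_adj_iff z (fun hzc => hcD (hzc ▸ hz)) hzf c).2 rfl).symm).symm
    have hE : IsSuperDominated G (f ⁻¹' D) := by
      refine h.isSuperDominated_preimage hD fun hc hv => hzf v ?_
      have hzc : z ≠ c := fun hzc => hc (hzc ▸ hz)
      exact (h.eq_center_of_leaf_mem hD hz hzc hzf).2 _ hv ((h.center_adj_iff v).2 rfl)
    refine (h.ncard_le z fun w hw => ?_).trans (Nat.add_le_add_right hE.ncard_le 1)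
    by_cases hwf : ∃ a, f a = w
    · obtain ⟨a, rfl⟩ := hwf
      exact .inr ⟨a, hw, rfl⟩
    · push Not at hwf
      exact .inl (key w hw hwf)

/-- Private neighbors in `G` survive adding one vertex `z` to the image of a super dominated
set, if they are not adjacent to `z`. -/
lemma isSuperDominated_insert (h : IsStarExtension G H f v c) {D : Set V} {z : W} (hz : z ∉ f '' D)
    (hzp : ∃ p, p ≠ z ∧ (∀ x ∈ D, f x ≠ p) ∧ H.Adj p z ∧ ∀ x ∈ D, ¬ H.Adj p (f x))
    (hD : ∀ w ∈ D, ∃ p, p ∉ D ∧ f p ≠ z ∧ ¬ H.Adj (f p) z ∧ G.Adj p w ∧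
      ∀ x ∈ D, G.Adj p x → x = w) :
    IsSuperDominated H (insert z (f '' D)) := by
  rintro w (rfl | ⟨w, hw, rfl⟩)
  · obtain ⟨p, hpw, hpD, hpa, hp⟩ := hzp
    refine ⟨p, ?_, hpa, ?_⟩
    · rintro (h1 | ⟨x, hx, hxp⟩)
      · exact hpw h1
      · exact hpD x hx hxp
    · rintro _ (rfl | ⟨x, hx, rfl⟩) hpx
      · rfl
      · exact absurd hpx (hp x hx)
  · obtain ⟨p, hpD, hpz, hpz', hpw, hp⟩ := hD w hw
    refine ⟨f p, ?_, (h.adj_iff _ _).2 hpw, ?_⟩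
    · rintro (h1 | ⟨x, hx, hxp⟩)
      · exact hpz h1
      · exact hpD (h.injective hxp ▸ hx)
    · rintro _ (rfl | ⟨x, hx, rfl⟩) hpx
      · exact absurd hpx hpz'
      · rw [hp x hx ((h.adj_iff _ _).1 hpx)]

/-- Attaching a star with at least one leaf `l` raises the number by one: a super dominated set
of `G` is enlarged by `c` if it contains `v`, and by `l` otherwise. -/
lemma superDominatedNumber_eq [Finite W] (h : IsStarExtension G H f v c) {l : W} (hlc : l ≠ c)
    (hl : ∀ a, f a ≠ l) : superDominatedNumber H = superDominatedNumber G + 1 := by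
  have := h.finite
  refine le_antisymm h.superDominatedNumber_le ?_
  obtain ⟨D, hD, hDc⟩ := exists_isSuperDominated_ncard_eq G
  have hlx := h.leaf_adj_iff l hlc hl
  rw [← hDc]
  by_cases hv : v ∈ D
  · have hc : c ∉ f '' D := by rintro ⟨x, -, hx⟩; exact h.ne_center x hx
    rw [← h.ncard_insert D hc]
    refine (h.isSuperDominated_insert hc ⟨l, hlc, fun x _ => hl x, (hlx c).2 rfl,
      fun x _ hx => h.ne_center x ((hlx _).1 hx)⟩ fun w hw => ?_).ncard_le
    obtain ⟨p, hpD, hpw, hp⟩ := hD w hw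
    exact ⟨p, hpD, h.ne_center p, fun hpc => hpD ((h.center_adj_iff p).1 hpc.symm ▸ hv), hpw, hp⟩
  · have hl' : l ∉ f '' D := by rintro ⟨x, -, hx⟩; exact hl x hx
    rw [← h.ncard_insert D hl']
    refine (h.isSuperDominated_insert hl' ⟨c, hlc.symm, fun x _ => h.ne_center x,
      ((hlx c).2 rfl).symm, fun x hx hcx => hv ((h.center_adj_iff x).1 hcx ▸ hx)⟩
      fun w hw => ?_).ncard_le
    obtain ⟨p, hpD, hpw, hp⟩ := hD w hw
    exact ⟨p, hpD, hl p, fun hpl => h.ne_center p ((hlx _).1 hpl.symm), hpw, hp⟩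

/-- Attaching a pendant vertex at `v` raises the number exactly at the attachable vertices. -/
lemma superDominatedNumber_eq_iff [Finite W] (h : IsStarExtension G H f v c)
    (hG : G.IsAcyclic) (hW : ∀ w, w ≠ c → ∃ a, f a = w) :
    superDominatedNumber G + 1 ≤ superDominatedNumber H ↔ Attachable G v := by
  have := h.finite
  rw [attachable_iff hG]
  constructor
  · intro hle
    obtain ⟨D, hD, hDc⟩ := exists_isSuperDominated_ncard_eq H
    rw [← hDc] at hle
    by_cases hc : c ∈ D
    · have hE := h.isSuperDominated_preimage hD fun h => absurd hc h
      have hcard : D.ncard ≤ (f ⁻¹' D).ncard + 1 := by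
        refine h.ncard_le c fun w hw => ?_
        by_cases hwc : w = c
        · exact .inl hwc
        · obtain ⟨a, rfl⟩ := hW w hwc
          exact .inr ⟨a, hw, rfl⟩
      obtain ⟨p, hpD, hpc, hp⟩ := hD c hc
      obtain ⟨a, rfl⟩ := hW p hpc.ne
      obtain rfl := (h.center_adj_iff a).1 hpc.symm
      exact ⟨f ⁻¹' D, hE, le_antisymm hE.ncard_le (by omega), hpD,
        .inl fun x hx hax => h.ne_center x (hp _ hx ((h.adj_iff _ _).2 hax))⟩
    · have hE := h.isSuperDominated_preimage_diff hD
      have hDf : D = f '' (f ⁻¹' D) := by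
        rw [Set.image_preimage_eq_inter_range, eq_comm, Set.inter_eq_left]
        intro w hw
        exact hW w fun hwc => hc (hwc ▸ hw)
      have hcard : D.ncard = (f ⁻¹' D).ncard := by
        conv_lhs => rw [hDf]
        exact Set.ncard_image_of_injective _ h.injective
      have hv : f v ∈ D := by
        by_contra hv
        rw [Set.sdiff_singleton_eq_self (show v ∉ f ⁻¹' D from hv)] at hE
        have := hE.ncard_le
        omega
      have hcard' := Set.ncard_sdiff_singleton_add_one (s := f ⁻¹' D) (a := v) hv
      refine ⟨_, hE, le_antisymm hE.ncard_le (by omega), fun h => h.2 rfl, .inr ?_⟩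
      rintro w ⟨hw, hwv⟩
      obtain ⟨p, hpD, hpw, hp⟩ := h.exists_private hD hw fun _ => hwv
      exact ⟨p, fun hp' => hpD hp'.1, fun hpv => hpD (hpv ▸ hv),
        fun hvp => hwv (hp v hv hvp.symm).symm, hpw, fun x hx => hp x hx.1⟩
  · rintro ⟨D, hD, hDc, hv, hD' | hD'⟩ <;> rw [← hDc]
    · have hc : c ∉ f '' D := by rintro ⟨x, -, hx⟩; exact h.ne_center x hx
      rw [← h.ncard_insert D hc]
      refine (h.isSuperDominated_insert hc ⟨f v, h.ne_center v,
        fun x hx hxv => hv (h.injective hxv ▸ hx), ((h.center_adj_iff v).2 rfl).symm,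
        fun x hx hvx => hD' x hx ((h.adj_iff _ _).1 hvx)⟩ fun w hw => ?_).ncard_le
      obtain ⟨p, hpD, hpw, hp⟩ := hD w hw
      refine ⟨p, hpD, h.ne_center p, fun hpc => ?_, hpw, hp⟩
      exact hD' w hw ((h.center_adj_iff p).1 hpc.symm ▸ hpw)
    · have hv' : f v ∉ f '' D := by rintro ⟨x, hx, hxv⟩; exact hv (h.injective hxv ▸ hx)
      rw [← h.ncard_insert D hv']
      refine (h.isSuperDominated_insert hv' ⟨c, (h.ne_center v).symm, fun x _ => h.ne_center x,
        (h.center_adj_iff v).2 rfl, fun x hx hcx => hv ((h.center_adj_iff x).1 hcx ▸ hx)⟩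
        fun w hw => ?_).ncard_le
      obtain ⟨p, hpD, hpv, hvp, hpw, hp⟩ := hD' w hw
      exact ⟨p, hpD, fun h' => hpv (h.injective h'),
        fun h' => hvp ((h.adj_iff _ _).1 h').symm, hpw, hp⟩

end IsStarExtension

/-! ### Subdivisions -/

section Subdivide

variable {V : Type*} {G : SimpleGraph V} {F : Set (Sym2 V)}

@[simp]
lemma subdivide_adj_inl_inl {a b : V} :
    (subdivide G F).Adj (.inl a) (.inl b) ↔ G.Adj a b ∧ s(a, b) ∉ F := Iff.rfl

@[simp]
lemma subdivide_adj_inl_inr {a : V} {e : F} :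
    (subdivide G F).Adj (.inl a) (.inr e) ↔ a ∈ e.1 := Iff.rfl

@[simp]
lemma subdivide_adj_inr_inl {a : V} {e : F} :
    (subdivide G F).Adj (.inr e) (.inl a) ↔ a ∈ e.1 := Iff.rfl

lemma superDominationNumber_lt_subdivide_iff [Finite V] :
    superDominationNumber G < superDominationNumber (subdivide G F) ↔
      superDominatedNumber (subdivide G F) < superDominatedNumber G + F.ncard := by
  have h1 := superDominationNumber_add G
  have h2 := superDominationNumber_add (subdivide G F)
  rw [Nat.card_sum, Nat.card_coe_set_eq] at h2
  omega

lemma superDominatedNumber_le_subdivide_empty [Finite V] (G : SimpleGraph V) :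
    superDominatedNumber G ≤ superDominatedNumber (subdivide G ∅) := by
  obtain ⟨D, hD, hDc⟩ := exists_isSuperDominated_ncard_eq G
  rw [← hDc, ← Set.ncard_image_of_injective D (Sum.inl_injective (β := (∅ : Set (Sym2 V))))]
  refine IsSuperDominated.ncard_le ?_
  rintro _ ⟨w, hw, rfl⟩
  obtain ⟨p, hpD, hpw, hp⟩ := hD w hw
  refine ⟨.inl p, ?_, ⟨hpw, Set.notMem_empty _⟩, ?_⟩
  · rintro ⟨x, hx, hxp⟩
    exact hpD (Sum.inl_injective hxp ▸ hx)
  · rintro _ ⟨x, hx, rfl⟩ hpx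
    rw [hp x hx hpx.1]

end Subdivide

/-- Subdividing any single edge of `G` does not raise the super domination number; equivalently,
it raises `superDominatedNumber`. -/
def IsStable {V : Type*} (G : SimpleGraph V) : Prop :=
  ∀ e ∈ G.edgeSet, superDominatedNumber G + 1 ≤ superDominatedNumber (subdivide G {e})

namespace IsStarExtension

variable {V W : Type*} {G : SimpleGraph V} {H : SimpleGraph W} {f : V → W} {v : V} {c : W}

lemma induce {A : Set W} {v c : W} (hv : v ∈ A) (hc : c ∉ A)
    (hadj : ∀ a ∈ A, H.Adj c a ↔ a = v) (hleaf : ∀ w, w ∉ A → w ≠ c → ∀ x, H.Adj w x ↔ x = c) :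
    IsStarExtension (H.induce A) H Subtype.val ⟨v, hv⟩ c where
  injective := Subtype.val_injective
  adj_iff _ _ := Iff.rfl
  ne_center a ha := hc (ha ▸ a.2)
  center_adj_iff a := by rw [hadj _ a.2, Subtype.ext_iff]
  leaf_adj_iff w hwc hw := hleaf w (fun hwA => hw ⟨w, hwA⟩ rfl) hwc

lemma subdivide_image (h : IsStarExtension G H f v c) (F : Set (Sym2 V)) :
    IsStarExtension (subdivide G F) (subdivide H (Sym2.map f '' F))
      (Sum.map f fun e => ⟨Sym2.map f e.1, Set.mem_image_of_mem _ e.2⟩) (.inl v) (.inl c) := by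
  have hF : ∀ w, (∀ a, f a ≠ w) → ∀ e ∈ Sym2.map f '' F, w ∉ e := by
    rintro w hw _ ⟨e, -, rfl⟩ hwe
    obtain ⟨a, -, ha⟩ := Sym2.mem_map.1 hwe
    exact hw a ha
  have hmem : ∀ a e, f a ∈ Sym2.map f e ↔ a ∈ e := by
    intro a e
    rw [Sym2.mem_map]
    exact ⟨fun ⟨b, hb, hba⟩ => h.injective hba ▸ hb, fun ha => ⟨a, ha, rfl⟩⟩
  have hinj := Sym2.map.injective h.injective
  refine ⟨?_, ?_, ?_, ?_, ?_⟩
  · refine Function.Injective.sumMap h.injective fun d e hde => ?_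
    exact Subtype.ext (hinj (congrArg Subtype.val hde))
  · rintro (a | d) (b | e)
    · simp only [Sum.map_inl, subdivide_adj_inl_inl, h.adj_iff]
      rw [← Sym2.map_mk, hinj.mem_set_image]
    · exact hmem a e
    · exact hmem b d
    · exact Iff.rfl
  · rintro (a | d)
    · simpa using h.ne_center a
    · simp
  · rintro (a | d)
    · have : s(c, f a) ∉ Sym2.map f '' F := fun hm => hF c h.ne_center _ hm (Sym2.mem_mk_left _ _)
      simp [h.center_adj_iff, this]
    · simpa using hF c h.ne_center _ (Set.mem_image_of_mem _ d.2)
  · rintro (w | ⟨_, e, he, rfl⟩) hwc hw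
    · have hw' : ∀ a, f a ≠ w := fun a ha => hw (.inl a) (congrArg Sum.inl ha)
      have hwc' : w ≠ c := fun h' => hwc (congrArg Sum.inl h')
      rintro (x | d)
      · have : s(w, x) ∉ Sym2.map f '' F := fun hm => hF w hw' _ hm (Sym2.mem_mk_left _ _)
        simp [h.leaf_adj_iff w hwc' hw', this]
      · simpa using hF w hw' _ d.2
    · exact absurd rfl (hw (.inr ⟨e, he⟩))

lemma superDominatedNumber_subdivide_image [Finite W] (h : IsStarExtension G H f v c) {l : W}
    (hlc : l ≠ c) (hl : ∀ a, f a ≠ l) (F : Set (Sym2 V)) :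
    superDominatedNumber (subdivide H (Sym2.map f '' F)) =
      superDominatedNumber (subdivide G F) + 1 := by
  refine (h.subdivide_image F).superDominatedNumber_eq (l := .inl l) (by simpa using hlc) ?_
  rintro (a | d)
  · simpa using hl a
  · simp

/-- Subdividing the edge joining the star to `G` leaves the star attached to a pendant vertex
at `v`. -/
lemma subdivide_join_edge [Finite W] (h : IsStarExtension G H f v c) (hG : G.IsAcyclic) {l : W}
    (hlc : l ≠ c) (hl : ∀ a, f a ≠ l) :
    superDominatedNumber G + 2 ≤ superDominatedNumber (subdivide H {s(f v, c)}) ↔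
      Attachable G v := by
  let e : ({s(f v, c)} : Set (Sym2 W)) := ⟨s(f v, c), rfl⟩
  have he : ∀ d, d = e := fun d => Subsingleton.elim _ _
  let A : Set (W ⊕ ({s(f v, c)} : Set (Sym2 W))) := {x | x = .inr e ∨ ∃ a, .inl (f a) = x}
  have hA : ∀ w, .inl w ∈ A ↔ ∃ a, f a = w := by simp [A]
  have heA : .inr e ∈ A := .inl rfl
  have outer : IsStarExtension ((subdivide H {s(f v, c)}).induce A) (subdivide H {s(f v, c)})
      Subtype.val ⟨.inr e, heA⟩ (.inl c) := by
    refine induce heA (by simpa [hA] using h.ne_center) ?_ ?_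
    · rintro _ (rfl | ⟨a, rfl⟩)
      · simp [e]
      · simp only [subdivide_adj_inl_inl, h.center_adj_iff, Set.mem_singleton_iff, reduceCtorEq,
          iff_false]
        rintro ⟨rfl, h2⟩
        exact h2 Sym2.eq_swap
    · rintro (w | d) hw hwc
      · have hwc' : w ≠ c := fun h' => hwc (congrArg Sum.inl h')
        have hwf : ∀ a, f a ≠ w := fun a ha => hw ((hA w).2 ⟨a, ha⟩)
        rintro (x | d)
        · have : s(w, x) ≠ s(f v, c) := fun h' => by
            have := h' ▸ Sym2.mem_mk_left w x
            rcases Sym2.mem_iff.1 this with h1 | h1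
            · exact hwf v h1.symm
            · exact hwc' h1
          simp [h.leaf_adj_iff w hwc' hwf, this]
        · simp [he d, e, hwc', (hwf v).symm]
      · exact absurd heA (he d ▸ hw)
  have inner : IsStarExtension G ((subdivide H {s(f v, c)}).induce A)
      (fun a => ⟨.inl (f a), (hA _).2 ⟨a, rfl⟩⟩) v ⟨.inr e, heA⟩ := by
    refine ⟨?_, ?_, ?_, ?_, ?_⟩
    · intro a b hab
      simpa [h.injective.eq_iff] using hab
    · intro a b
      have : s(f a, f b) ≠ s(f v, c) := fun h' => by
        rcases Sym2.mem_iff.1 (h'.symm ▸ Sym2.mem_mk_right (f v) c) with h1 | h1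
        · exact h.ne_center a h1.symm
        · exact h.ne_center b h1.symm
      simp [h.adj_iff, this]
    · simp
    · intro a
      simp [e, h.injective.eq_iff, h.ne_center]
    · rintro ⟨_, rfl | ⟨a, rfl⟩⟩ h1 h2
      · exact absurd rfl h1
      · exact absurd rfl (h2 a)
  rw [outer.superDominatedNumber_eq (l := .inl l) (by simpa using hlc)
    fun a ha => by obtain ⟨b, hb⟩ := (hA l).1 (ha ▸ a.2); exact hl b hb,
    ← inner.superDominatedNumber_eq_iff hG]
  · omega
  · rintro ⟨_, rfl | ⟨a, rfl⟩⟩ h1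
    · exact absurd rfl h1
    · exact ⟨a, rfl⟩

/-- Subdividing the edge from `c` to a leaf `l` leaves a star of order two attached at `c`, so the
other leaves, if any, give one star and the last edge another. -/
lemma le_subdivide_leaf_edge [Finite W] (h : IsStarExtension G H f v c) (hG : G.IsAcyclic) {l : W}
    (hlc : l ≠ c) (hl : ∀ a, f a ≠ l) (hv : Attachable G v) :
    superDominatedNumber G + 2 ≤ superDominatedNumber (subdivide H {s(c, l)}) := by
  let e : ({s(c, l)} : Set (Sym2 W)) := ⟨s(c, l), rfl⟩
  have he : ∀ d, d = e := fun d => Subsingleton.elim _ _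
  let A : Set (W ⊕ ({s(c, l)} : Set (Sym2 W))) := {x | ∃ w, w ≠ l ∧ .inl w = x}
  have hA : ∀ w, .inl w ∈ A ↔ w ≠ l := by simp [A]
  have hAe : ∀ d, .inr d ∉ A := by simp [A]
  have hcA := (hA c).2 hlc.symm
  have hne : ∀ x y, x ≠ l → y ≠ l → s(x, y) ≠ s(c, l) := fun x y hx hy h' => by
    rcases Sym2.mem_iff.1 (h'.symm ▸ Sym2.mem_mk_right c l) with h1 | h1
    · exact hx h1.symm
    · exact hy h1.symm
  have outer : IsStarExtension ((subdivide H {s(c, l)}).induce A) (subdivide H {s(c, l)})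
      Subtype.val ⟨.inl c, hcA⟩ (.inr e) := by
    refine induce hcA (hAe e) ?_ ?_
    · rintro _ ⟨w, hw, rfl⟩
      simp [e, hw]
    · rintro (w | d) hw hwc
      · have hwl : w = l := not_not.1 fun h' => hw ((hA w).2 h')
        subst hwl
        rintro (x | d)
        · simp only [subdivide_adj_inl_inl, h.leaf_adj_iff w hlc hl, Set.mem_singleton_iff,
            reduceCtorEq, iff_false]
          rintro ⟨rfl, h2⟩
          exact h2 Sym2.eq_swap
        · simp [he d, e]
      · exact absurd (congrArg Sum.inr (he d)) hwc
  have inner : IsStarExtension G ((subdivide H {s(c, l)}).induce A)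
      (fun a => ⟨.inl (f a), (hA _).2 (hl a)⟩) v ⟨.inl c, hcA⟩ := by
    refine ⟨?_, ?_, ?_, ?_, ?_⟩
    · intro a b hab
      simpa [h.injective.eq_iff] using hab
    · intro a b
      simp [h.adj_iff, hne _ _ (hl a) (hl b)]
    · intro a
      simpa using h.ne_center a
    · intro a
      simp [h.center_adj_iff, hne _ _ hlc.symm (hl a)]
    · rintro ⟨_, w, hw, rfl⟩ h1 h2 ⟨_, x, hx, rfl⟩
      have h1' : w ≠ c := fun h' => h1 (Subtype.ext (congrArg Sum.inl h'))
      have h2' : ∀ a, f a ≠ w := fun a h' => h2 a (Subtype.ext (congrArg Sum.inl h'))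
      simp [h.leaf_adj_iff w h1' h2', hne _ _ hw hx]
  rw [outer.superDominatedNumber_eq (l := .inl l) (by simp)
    fun a ha => (hA l).1 (ha ▸ a.2) rfl]
  by_cases hl' : ∃ l', l' ≠ l ∧ l' ≠ c ∧ ∀ a, f a ≠ l'
  · obtain ⟨l', h1, h2, h3⟩ := hl'
    rw [inner.superDominatedNumber_eq (l := ⟨.inl l', (hA l').2 h1⟩) (by simpa using h2)
      (fun a => by simpa using h3 a)]
  · push Not at hl'
    have := (inner.superDominatedNumber_eq_iff hG ?_).2 hv
    · omega
    · rintro ⟨_, w, hw, rfl⟩ h1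
      obtain ⟨a, ha⟩ := hl' w hw fun h' => h1 (Subtype.ext (congrArg Sum.inl h'))
      exact ⟨a, Subtype.ext (congrArg Sum.inl ha)⟩

lemma isStable_iff [Finite W] (h : IsStarExtension G H f v c) (hG : G.IsAcyclic) {l : W}
    (hlc : l ≠ c) (hl : ∀ a, f a ≠ l) : IsStable H ↔ IsStable G ∧ Attachable G v := by
  have hHG := h.superDominatedNumber_eq hlc hl
  have himage : ∀ e, superDominatedNumber (subdivide H {Sym2.map f e}) =
      superDominatedNumber (subdivide G {e}) + 1 := fun e => by
    rw [← Set.image_singleton]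
    exact h.superDominatedNumber_subdivide_image hlc hl {e}
  have hjoin := h.subdivide_join_edge hG hlc hl
  constructor
  · intro hH
    constructor
    · intro e he
      have hmem : Sym2.map f e ∈ H.edgeSet := by
        induction e with
        | h a b => exact (h.adj_iff a b).2 he
      have := hH _ hmem
      rw [himage] at this
      omega
    · rw [← hjoin]
      have := hH s(f v, c) ((h.center_adj_iff v).2 rfl).symm
      omega
  · rintro ⟨hst, hv⟩
    have hc : ∀ x, H.Adj c x →
        superDominatedNumber H + 1 ≤ superDominatedNumber (subdivide H {s(c, x)}) := by
      intro x hx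
      rcases center_or_image_or_leaf (f := f) (c := c) x with rfl | ⟨a, rfl⟩ | ⟨h1, h2⟩
      · exact absurd rfl hx.ne
      · obtain rfl := (h.center_adj_iff a).1 hx
        rw [Sym2.eq_swap]
        have := hjoin.2 hv
        omega
      · have := h.le_subdivide_leaf_edge hG h1 h2 hv
        omega
    intro e he
    induction e with
    | h x y =>
      have hxy : H.Adj x y := he
      rcases center_or_image_or_leaf (f := f) (c := c) x with rfl | ⟨a, rfl⟩ | ⟨h1, h2⟩
      · exact hc y hxy
      · rcases center_or_image_or_leaf (f := f) (c := c) y with rfl | ⟨b, rfl⟩ | ⟨h1, h2⟩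
        · rw [Sym2.eq_swap]
          exact hc _ hxy.symm
        · have := hst s(a, b) ((h.adj_iff a b).1 hxy)
          rw [← Sym2.map_mk, himage]
          omega
        · exact absurd ((h.leaf_adj_iff y h1 h2 _).1 hxy.symm) (h.ne_center a)
      · obtain rfl := (h.leaf_adj_iff x h1 h2 _).1 hxy
        rw [Sym2.eq_swap]
        exact hc _ hxy.symm

end IsStarExtension

/-! ### Stars -/

section Star

variable {V : Type*} {G : SimpleGraph V}

lemma one_le_superDominatedNumber [Finite V] {x y : V} (h : G.Adj x y) :
    1 ≤ superDominatedNumber G := by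
  rw [← Set.ncard_singleton y]
  refine IsSuperDominated.ncard_le ?_
  rintro _ rfl
  exact ⟨x, h.ne, h, fun z hz _ => hz⟩

lemma superDominatedNumber_subdivide_le [Finite V] {F : Set (Sym2 V)} (C : Set V)
    (hC : ∀ x y, G.Adj x y → x ∈ C ∨ y ∈ C) (hF : ∀ e ∈ F, ∀ x ∈ e, x ∈ C) :
    superDominatedNumber (subdivide G F) ≤ C.ncard := by
  rw [← Set.ncard_image_of_injective C (Sum.inl_injective (β := F))]
  refine superDominatedNumber_le_of_cover _ ?_
  rintro (x | d) (y | e) h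
  · exact (hC x y h.1).imp (Set.mem_image_of_mem _) (Set.mem_image_of_mem _)
  · exact .inl (Set.mem_image_of_mem _ (hF _ e.2 x h))
  · exact .inr (Set.mem_image_of_mem _ (hF _ d.2 y h))
  · exact h.elim

lemma superDominatedNumber_subdivide_edgeSet_le [Finite V] (G : SimpleGraph V) :
    superDominatedNumber (subdivide G G.edgeSet) ≤ G.edgeSet.ncard := by
  rw [← Nat.card_coe_set_eq, ← Set.ncard_univ,
    ← Set.ncard_image_of_injective _ (Sum.inr_injective (α := V))]
  refine superDominatedNumber_le_of_cover _ ?_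
  rintro (x | d) (y | e) h
  · exact absurd h.1 h.2
  all_goals simp

lemma edgeSet_starGraph (a : V) : (starGraph a).edgeSet = (fun x => s(a, x)) '' {a}ᶜ := by
  ext e
  induction e with
  | h x y =>
    simp only [mem_edgeSet, starGraph_adj, Set.mem_image, Set.mem_compl_iff,
      Set.mem_singleton_iff]
    constructor
    · rintro ⟨hxy, rfl | rfl⟩
      · exact ⟨y, fun h => hxy h.symm, rfl⟩
      · exact ⟨x, hxy, Sym2.eq_swap⟩
    · rintro ⟨z, hz, h⟩
      rcases Sym2.eq_iff.1 h with ⟨rfl, rfl⟩ | ⟨rfl, rfl⟩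
      · exact ⟨fun h => hz h.symm, .inl rfl⟩
      · exact ⟨hz, .inr rfl⟩

lemma injective_sym2_mk (a : V) : Function.Injective fun x => s(a, x) :=
  fun _ _ h => Sym2.congr_right.1 h

lemma ncard_edgeSet_starGraph [Finite V] (a : V) :
    (starGraph a).edgeSet.ncard + 1 = Nat.card V := by
  rw [edgeSet_starGraph, Set.ncard_image_of_injective _ (injective_sym2_mk a),
    ← Set.ncard_add_ncard_compl {a}, Set.ncard_singleton, add_comm]

lemma superDominatedNumber_starGraph [Finite V] [Nontrivial V] (a : V) :
    superDominatedNumber (starGraph a) = 1 := by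
  obtain ⟨b, hb⟩ := exists_ne a
  refine le_antisymm ?_ (one_le_superDominatedNumber (starGraph_center_adj hb.symm))
  rw [← Set.ncard_singleton a]
  exact superDominatedNumber_le_of_cover _ fun x y h => (starGraph_adj.1 h).2

/-- If some edge of a star is not subdivided, its leaf, whose private neighbor is the center, can
be added to the leaves on the subdivided edges. -/
lemma le_superDominatedNumber_subdivide_starGraph [Finite V] (a : V) {F : Set (Sym2 V)}
    (hF : F ⊂ (starGraph a).edgeSet) :
    F.ncard + 1 ≤ superDominatedNumber (subdivide (starGraph a) F) := by
  obtain ⟨hsub, e, he, heF⟩ := Set.ssubset_iff_exists.1 hF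
  rw [edgeSet_starGraph] at he hsub
  obtain ⟨b, hb, rfl⟩ := he
  obtain ⟨L, hL, rfl⟩ := Set.subset_image_iff.1 hsub
  have hinj := injective_sym2_mk a
  have hbL : b ∉ L := fun h => heF (Set.mem_image_of_mem _ h)
  rw [Set.ncard_image_of_injective _ hinj, ← Set.ncard_insert_of_notMem hbL,
    ← Set.ncard_image_of_injective _ (Sum.inl_injective (β := (fun x => s(a, x)) '' L))]
  have hbL' : insert b L ⊆ {a}ᶜ := Set.insert_subset hb hL
  refine IsSuperDominated.ncard_le ?_
  rintro _ ⟨w, rfl | hw, rfl⟩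
  · refine ⟨.inl a, ?_, ⟨starGraph_center_adj (Ne.symm hb), heF⟩, ?_⟩
    · rintro ⟨x, hx, hxa⟩
      exact hbL' hx (Sum.inl_injective hxa)
    · rintro _ ⟨x, rfl | hx, rfl⟩ hax
      · rfl
      · exact absurd (Set.mem_image_of_mem _ hx) hax.2
  · refine ⟨.inr ⟨_, Set.mem_image_of_mem _ hw⟩, by simp, Sym2.mem_mk_right _ _, ?_⟩
    rintro _ ⟨x, hx, rfl⟩ hax
    rcases Sym2.mem_iff.1 hax with h | h
    · exact absurd h (hbL' hx)
    · rw [h]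

lemma exists_equiv_apply_eq {α β : Type*} [Finite α] [Finite β] (h : Nat.card α = Nat.card β)
    (a : α) (b : β) : ∃ e : α ≃ β, e a = b := by
  classical
  obtain ⟨e⟩ := Finite.card_eq.1 h
  exact ⟨e.setValue a b, e.setValue_eq a b⟩

lemma nonempty_iso_starGraph_iff [Finite V] {m : ℕ} :
    Nonempty (G ≃g starGraph (0 : Fin (m + 1))) ↔ ∃ a, G = starGraph a ∧ Nat.card V = m + 1 := by
  constructor
  · rintro ⟨e⟩
    refine ⟨e.symm 0, ?_, by rw [Nat.card_congr e.toEquiv, Nat.card_fin]⟩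
    ext x y
    rw [← e.map_adj_iff, starGraph_adj, starGraph_adj, RelIso.eq_symm_apply, RelIso.eq_symm_apply,
      e.injective.ne_iff]
  · rintro ⟨a, rfl, h⟩
    obtain ⟨e, he⟩ := exists_equiv_apply_eq (h.trans (Nat.card_fin _).symm) a (0 : Fin (m + 1))
    refine ⟨⟨e, ?_⟩⟩
    intro x y
    rw [starGraph_adj, starGraph_adj, e.injective.ne_iff, ← he, e.injective.eq_iff,
      e.injective.eq_iff]

lemma attachable_of_subsingleton [Subsingleton V] (G : SimpleGraph V) (v : V) :
    Attachable G v := by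
  refine (attachable_iff .of_subsingleton).2 ⟨∅, isSuperDominated_empty, ?_, by simp, by simp⟩
  have := superDominatedNumber_le_of_cover (G := G) ∅
    fun x y h => absurd (Subsingleton.elim x y) h.ne
  simp only [Set.ncard_empty] at this ⊢
  omega

lemma isStable_of_subsingleton [Subsingleton V] (G : SimpleGraph V) : IsStable G := by
  intro e
  induction e with
  | h x y => exact fun h => absurd (Subsingleton.elim x y) (show G.Adj x y from h).ne

/-- A star of order at least three arises by attaching a star to a graph with one vertex. -/
lemma isStable_starGraph [Finite V] (a : V) (h : 3 ≤ Nat.card V) : IsStable (starGraph a) := by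
  have : Nontrivial V := Finite.one_lt_card_iff_nontrivial.1 (by omega)
  obtain ⟨b, hb⟩ := exists_ne a
  obtain ⟨l, hl⟩ : ∃ l, l ∉ ({a, b} : Set V) := by
    by_contra! hl
    have := Set.ncard_le_ncard (s := Set.univ) (t := {a, b}) fun x _ => hl x
    rw [Set.ncard_univ, Set.ncard_pair hb.symm] at this
    omega
  simp only [Set.mem_insert_iff, Set.mem_singleton_iff, not_or] at hl
  have hext : IsStarExtension (⊥ : SimpleGraph Unit) (starGraph a) (fun _ => b) () a := by
    refine ⟨fun _ _ _ => rfl, by simp, fun _ => hb, fun _ => by simp [hb.symm], ?_⟩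
    intro w hwa _ x
    rw [starGraph_adj]
    grind
  exact (hext.isStable_iff .of_subsingleton hl.1 fun _ => Ne.symm hl.2).2
    ⟨isStable_of_subsingleton _, attachable_of_subsingleton _ _⟩

end Star

/-! ### Graphs in the family -/

section AttachStar

variable {V W : Type*} {G : SimpleGraph V} {v : V} {m : ℕ}

@[simp]
lemma attachStar_adj_inl_inl {a b : V} :
    (attachStar G v m).Adj (.inl a) (.inl b) ↔ G.Adj a b := by
  simp [attachStar, edge_adj]

@[simp]
lemma attachStar_adj_inl_inr {a : V} {i : Fin (m + 1)} :
    (attachStar G v m).Adj (.inl a) (.inr i) ↔ a = v ∧ i = 0 := by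
  simp [attachStar, edge_adj]

@[simp]
lemma attachStar_adj_inr_inl {a : V} {i : Fin (m + 1)} :
    (attachStar G v m).Adj (.inr i) (.inl a) ↔ a = v ∧ i = 0 := by
  rw [adj_comm, attachStar_adj_inl_inr]

@[simp]
lemma attachStar_adj_inr_inr {i j : Fin (m + 1)} :
    (attachStar G v m).Adj (.inr i) (.inr j) ↔ i ≠ j ∧ (i = 0 ∨ j = 0) := by
  simp [attachStar, edge_adj]

lemma isStarExtension_of_iso {H : SimpleGraph W} (e : H ≃g attachStar G v m) :
    IsStarExtension G H (fun a => e.symm (.inl a)) v (e.symm (.inr 0)) := by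
  refine ⟨e.symm.injective.comp Sum.inl_injective, ?_, ?_, ?_, ?_⟩
  · intro a b
    rw [e.symm.map_adj_iff, attachStar_adj_inl_inl]
  · intro a h
    simpa using e.symm.injective h
  · intro a
    rw [e.symm.map_adj_iff, attachStar_adj_inr_inl, and_iff_left rfl]
  · intro w hwc hw x
    obtain ⟨w, rfl⟩ := e.symm.surjective w
    obtain ⟨x, rfl⟩ := e.symm.surjective x
    rw [e.symm.map_adj_iff, e.symm.injective.eq_iff]
    rcases w with a | i
    · exact absurd rfl (hw a)
    · have hi : i ≠ 0 := fun h => hwc (h ▸ rfl)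
      rcases x with b | j
      · simp [hi]
      · simp only [attachStar_adj_inr_inr, Sum.inr.injEq]
        grind

lemma exists_leaf_of_iso {H : SimpleGraph W} (e : H ≃g attachStar G v m) (hm : 1 ≤ m) :
    ∃ l, l ≠ e.symm (.inr 0) ∧ ∀ a, e.symm (.inl a) ≠ l :=
  ⟨e.symm (.inr (Fin.last m)), fun h => by
    have := Sum.inr_injective (e.symm.injective h)
    exact absurd (congrArg Fin.val this) (by simp; omega),
    fun a h => by simpa using e.symm.injective h⟩

lemma IsStarExtension.nonempty_iso [Finite W] {H : SimpleGraph W} {f : V → W} {c l : W}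
    (h : IsStarExtension G H f v c) (hlc : l ≠ c) (hl : ∀ a, f a ≠ l) :
    ∃ m, 1 ≤ m ∧ Nonempty (H ≃g attachStar G v m) := by
  let B : Set W := {w | ∀ a, f a ≠ w}
  let c' : B := ⟨c, h.ne_center⟩
  have hB : 1 < Nat.card B := Finite.one_lt_card_iff_nontrivial.2
    ⟨⟨l, hl⟩, c', fun h' => hlc (congrArg Subtype.val h')⟩
  obtain ⟨m, hm⟩ : ∃ m, Nat.card B = m + 1 := ⟨_, (Nat.succ_pred_eq_of_pos (by omega)).symm⟩
  refine ⟨m, by omega, ?_⟩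
  obtain ⟨φ, hφ⟩ := exists_equiv_apply_eq ((Nat.card_fin _).trans hm.symm) (0 : Fin (m + 1)) c'
  have hφ0 : ∀ i, (φ i : W) = c ↔ i = 0 := fun i => by
    rw [← φ.injective.eq_iff, hφ, Subtype.ext_iff]
  have hbij : Function.Bijective (Sum.elim f fun i => (φ i : W)) := by
    constructor
    · exact h.injective.sumElim (Subtype.val_injective.comp φ.injective) fun a i => (φ i).2 a
    · intro w
      by_cases hw : ∃ a, f a = w
      · exact hw.imp' .inl fun _ => id
      · push Not at hw
        exact ⟨.inr (φ.symm ⟨w, hw⟩), by simp⟩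
  have hBf : ∀ i a, H.Adj (φ i) (f a) ↔ a = v ∧ i = 0 := by
    intro i a
    by_cases hi : i = 0
    · rw [(hφ0 i).2 hi, h.center_adj_iff]
      simp [hi]
    · rw [h.leaf_adj_iff _ (fun h' => hi ((hφ0 i).1 h')) (φ i).2]
      simp [hi, h.ne_center]
  refine ⟨RelIso.symm ⟨Equiv.ofBijective _ hbij, ?_⟩⟩
  rintro (a | i) (b | j)
  · simp [h.adj_iff]
  · simp [H.adj_comm (f a), hBf]
  · simp [hBf]
  · simp only [Equiv.ofBijective_apply, Sum.elim_inr, attachStar_adj_inr_inr]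
    by_cases hi : i = 0
    · subst hi
      by_cases hj : j = 0
      · subst hj
        simp
      · rw [H.adj_comm, h.leaf_adj_iff _ (fun h' => hj ((hφ0 j).1 h')) (φ j).2, hφ0]
        simp [Ne.symm hj]
    · rw [h.leaf_adj_iff _ (fun h' => hi ((hφ0 i).1 h')) (φ i).2, hφ0]
      grind

end AttachStar

lemma IsStarExtension.isAcyclic {V W : Type*} {G : SimpleGraph V} {H : SimpleGraph W} {f : V → W}
    {v : V} {c : W} (h : IsStarExtension G H f v c) (hH : H.IsAcyclic) : G.IsAcyclic :=
  hH.comap ⟨f, fun {a b} => (h.adj_iff a b).2⟩ h.injective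

lemma FamilyU.isStable {V : Type u} [Finite V] {T : SimpleGraph V} (h : FamilyU T)
    (hT : T.IsAcyclic) : IsStable T := by
  rename_i hfin
  revert hfin
  induction h with
  | star G m hm e =>
    intro _
    obtain ⟨a, rfl, hcard⟩ := nonempty_iso_starGraph_iff.1 ⟨e⟩
    exact isStable_starGraph a (by omega)
  | attach G' G h' v hv m hm e ih =>
    intro _
    have hext := isStarExtension_of_iso e
    have := hext.finite
    obtain ⟨l, hlc, hl⟩ := exists_leaf_of_iso e hm
    have hG' := hext.isAcyclic hT
    exact (hext.isStable_iff hG' hlc hl).2 ⟨ih hG', hv⟩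

open IsStarExtension in
/-- If a star is attached to a star with center `a` and at least three leaves, then it is attached
to a leaf `v`, and it suffices to subdivide both edges on the path from `a` through `v` to the
center `c` of the new star: afterwards `a`, `v` and `c` cover all edges. -/
lemma IsStarExtension.exists_two_edges {V W : Type*} [Finite W] {G : SimpleGraph V}
    {H : SimpleGraph W} {f : V → W} {v : V} {c l : W} (hext : IsStarExtension G H f v c)
    (hlc : l ≠ c) (hl : ∀ a, f a ≠ l) (hst : IsStable H)
    (hG : (∃ a, G = starGraph a ∧ 4 ≤ Nat.card V) ∨ ∃ F ⊆ G.edgeSet, F.ncard = 2 ∧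
      superDominatedNumber (subdivide G F) < superDominatedNumber G + 2) :
    ∃ F ⊆ H.edgeSet, F.ncard = 2 ∧
      superDominatedNumber (subdivide H F) < superDominatedNumber H + 2 := by
  have := hext.finite
  have heq := hext.superDominatedNumber_eq hlc hl
  rcases hG with ⟨a, rfl, hcard⟩ | ⟨F, hF, hF2, hlt⟩
  · have : Nontrivial V := Finite.one_lt_card_iff_nontrivial.1 (by omega : 1 < Nat.card V)
    rw [superDominatedNumber_starGraph] at heq
    have hjoin : H.Adj (f v) c := ((hext.center_adj_iff v).2 rfl).symm
    have hcover : ∀ x y, H.Adj x y → (x = f a ∨ x = c) ∨ (y = f a ∨ y = c) := by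
      intro x y hxy
      rcases center_or_image_or_leaf (f := f) (c := c) x with rfl | ⟨x, rfl⟩ | ⟨h1, h2⟩
      · exact .inl (.inr rfl)
      · rcases center_or_image_or_leaf (f := f) (c := c) y with rfl | ⟨y, rfl⟩ | ⟨h1, h2⟩
        · exact .inr (.inr rfl)
        · rcases (starGraph_adj.1 ((hext.adj_iff _ _).1 hxy)).2 with rfl | rfl
          · exact .inl (.inl rfl)
          · exact .inr (.inl rfl)
        · exact .inl (.inr ((hext.leaf_adj_iff y h1 h2 _).1 hxy.symm))
      · exact .inr (.inr ((hext.leaf_adj_iff x h1 h2 _).1 hxy))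
    by_cases hva : v = a
    -- A star cannot be attached at the center `a`: stability would fail at the joining edge.
    · subst hva
      have h1 := hst s(f v, c) hjoin
      have h2 := superDominatedNumber_subdivide_le (F := {s(f v, c)}) {f v, c} hcover (by simp)
      have h3 := Set.ncard_insert_le (f v) {c}
      rw [Set.ncard_singleton] at h3
      omega
    · refine ⟨{s(f a, f v), s(f v, c)}, ?_, ?_, ?_⟩
      · rintro _ (rfl | rfl)
        · exact (hext.adj_iff _ _).2 (starGraph_center_adj (Ne.symm hva))
        · exact hjoin
      · refine Set.ncard_pair fun h => ?_
        rcases Sym2.mem_iff.1 (h ▸ Sym2.mem_mk_left (f a) (f v)) with h | h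
        · exact hva (hext.injective h).symm
        · exact hext.ne_center _ h
      · have h2 := superDominatedNumber_subdivide_le
          (F := {s(f a, f v), s(f v, c)}) {f a, c, f v}
          (fun x y hxy => (hcover x y hxy).imp (by simp; tauto) (by simp; tauto)) (by simp)
        have h3 := Set.ncard_insert_le (f a) {c, f v}
        have h4 := Set.ncard_insert_le c {f v}
        rw [Set.ncard_singleton] at h4
        omega
  · refine ⟨Sym2.map f '' F, ?_, ?_, ?_⟩
    · rintro _ ⟨d, hd, rfl⟩
      have := hF hd
      induction d with
      | h x y => exact (hext.adj_iff x y).2 this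
    · rw [Set.ncard_image_of_injective _ (Sym2.map.injective hext.injective), hF2]
    · rw [hext.superDominatedNumber_subdivide_image hlc hl, heq]
      omega

lemma FamilyU.exists_two_edges {V : Type u} [Finite V] {T : SimpleGraph V} (h : FamilyU T)
    (hT : T.IsAcyclic) :
    (∃ a, T = starGraph a ∧ 4 ≤ Nat.card V) ∨ ∃ F ⊆ T.edgeSet, F.ncard = 2 ∧
      superDominatedNumber (subdivide T F) < superDominatedNumber T + 2 := by
  rename_i hfin
  revert hfin
  induction h with
  | @star V' G m hm e =>
    intro _
    obtain ⟨a, rfl, hcard⟩ := nonempty_iso_starGraph_iff.1 ⟨e⟩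
    by_cases hm' : 3 ≤ m
    · exact .inl ⟨a, rfl, by omega⟩
    · have h1 := ncard_edgeSet_starGraph a
      have h2 := superDominatedNumber_subdivide_edgeSet_le (starGraph a)
      have : Nontrivial V' := Finite.one_lt_card_iff_nontrivial.1 (by omega)
      have h3 := superDominatedNumber_starGraph a
      exact .inr ⟨_, subset_rfl, by omega, by omega⟩
  | attach G' G h' v hv m hm e ih =>
    intro _
    have hext := isStarExtension_of_iso e
    have := hext.finite
    obtain ⟨l, hlc, hl⟩ := exists_leaf_of_iso e hm
    exact .inr (hext.exists_two_edges hlc hl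
      ((FamilyU.attach G' G h' v hv m hm e).isStable hT) (ih (hext.isAcyclic hT)))

/-! ### Splitting off a star from a tree -/

section Tree

variable {V : Type*} {T : SimpleGraph V}

lemma exists_adj_dist_add_one_eq (hT : T.IsTree) {r x : V} (hx : x ≠ r) :
    ∃ y, T.Adj x y ∧ T.dist r y + 1 = T.dist r x := by
  obtain ⟨p, hp⟩ := hT.connected.exists_walk_length_eq_dist x r
  cases p with
  | nil => exact absurd rfl hx
  | cons h q =>
    refine ⟨_, h, ?_⟩
    have h1 := dist_le q
    rw [dist_comm] at h1
    rw [Walk.length_cons, dist_comm] at hp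
    have h2 := hT.dist_eq_dist_add_one_of_adj r h
    omega

lemma eq_of_adj_of_dist_add_one_eq (hT : T.IsTree) {r x y z : V} (hy : T.Adj x y)
    (hz : T.Adj x z) (hyd : T.dist r y + 1 = T.dist r x) (hzd : T.dist r z + 1 = T.dist r x) :
    y = z := by
  obtain ⟨p, hp⟩ := hT.connected.exists_walk_length_eq_dist r y
  obtain ⟨q, hq⟩ := hT.connected.exists_walk_length_eq_dist r z
  have h := (hT.isAcyclic.subsingleton_path r x).elim
    ⟨p.concat hy.symm, Walk.isPath_of_length_eq_dist _ (by rw [Walk.length_concat, hp, hyd])⟩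
    ⟨q.concat hz.symm, Walk.isPath_of_length_eq_dist _ (by rw [Walk.length_concat, hq, hzd])⟩
  simpa using congrArg Walk.penultimate (congrArg Subtype.val h)

lemma exists_ne_not_adj [Finite V] (hT : T.IsAcyclic) (hV : 3 ≤ Nat.card V) :
    ∃ x y, x ≠ y ∧ ¬ T.Adj x y := by
  have := Fintype.ofFinite V
  rw [Nat.card_eq_fintype_card] at hV
  obtain ⟨x, y, z, hxy, hxz, hyz⟩ := Fintype.two_lt_card_iff.1 hV
  by_contra! h
  exact not_adj_of_isAcyclic hT (h x y hxy) (h y z hyz) (h x z hxz)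

/-- If the root is not adjacent to every other vertex, then the parent `c` of a vertex farthest from
the root is the center of a star: all neighbors of `c` except its parent are leaves. -/
lemma exists_isStarExtension_induce [Finite V] (hT : T.IsTree) (hV : 3 ≤ Nat.card V) :
    ∃ (A : Set V) (v : A) (c l : V), IsStarExtension (T.induce A) T Subtype.val v c ∧
      l ≠ c ∧ l ∉ A ∧ (T.induce A).IsTree := by
  obtain ⟨r, x, hrx, hnadj⟩ := exists_ne_not_adj hT.isAcyclic hV
  have hx := hT.connected.one_lt_dist_of_ne_of_not_adj hrx hnadj
  have : Nonempty V := ⟨r⟩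
  obtain ⟨l, hl⟩ := Finite.exists_max (T.dist r)
  have hlx := hl x
  obtain ⟨c, hlc, hcd⟩ := exists_adj_dist_add_one_eq hT (r := r) (x := l)
    (by rintro rfl; rw [SimpleGraph.dist_self] at hlx; omega)
  have hrc : c ≠ r := by rintro rfl; rw [SimpleGraph.dist_self] at hcd; omega
  obtain ⟨v, hcv, hvd⟩ := exists_adj_dist_add_one_eq hT hrc
  let A : Set V := {x | x ≠ c ∧ ¬ (T.Adj c x ∧ T.dist r x = T.dist r c + 1)}
  have hvA : v ∈ A := ⟨hcv.ne', fun h => by omega⟩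
  have hcA : c ∉ A := fun h => h.1 rfl
  have hchild : ∀ w, T.Adj c w → T.dist r w = T.dist r c + 1 → ∀ x, T.Adj w x → x = c := by
    intro w hcw hw x hwx
    refine eq_of_adj_of_dist_add_one_eq hT hwx hcw.symm ?_ hw.symm
    have h1 := hT.dist_eq_dist_add_one_of_adj r hwx
    have h2 := hl x
    omega
  refine ⟨A, ⟨v, hvA⟩, c, l, IsStarExtension.induce hvA hcA ?_ ?_, hlc.ne,
    fun h => h.2 ⟨hlc.symm, hcd.symm⟩, ?_, hT.isAcyclic.induce A⟩
  · intro a ha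
    refine ⟨fun hca => ?_, fun h => h ▸ hcv⟩
    refine eq_of_adj_of_dist_add_one_eq hT hca hcv ?_ hvd
    have h1 := hT.dist_eq_dist_add_one_of_adj r hca
    have h2 : ¬ T.dist r a = T.dist r c + 1 := fun h => ha.2 ⟨hca, h⟩
    omega
  · intro w hwA hwc x
    have hw : T.Adj c w ∧ T.dist r w = T.dist r c + 1 := not_not.1 fun h => hwA ⟨hwc, h⟩
    exact ⟨hchild w hw.1 hw.2 x, fun h => h ▸ hw.1.symm⟩
  · have hrA : r ∈ A := ⟨hrc.symm, fun h => by
      have := h.2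
      rw [SimpleGraph.dist_self] at this
      omega⟩
    have key : ∀ n, ∀ x : A, T.dist r x = n → (T.induce A).Reachable x ⟨r, hrA⟩ := by
      intro n
      induction n with
      | zero =>
        intro x hx
        obtain rfl : x = ⟨r, hrA⟩ := Subtype.ext (hT.connected.dist_eq_zero_iff.1 hx).symm
        exact Reachable.refl _
      | succ n ih =>
        intro x hx
        obtain ⟨y, hxy, hy⟩ := exists_adj_dist_add_one_eq hT (r := r) (x := x.1)
          (by intro h; rw [h, SimpleGraph.dist_self] at hx; omega)
        have hyA : y ∈ A := by
          refine ⟨?_, fun h => x.2.1 (hchild y h.1 h.2 x hxy.symm)⟩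
          rintro rfl
          exact x.2.2 ⟨hxy.symm, hy.symm⟩
        have hadj : (T.induce A).Adj x ⟨y, hyA⟩ := hxy
        exact hadj.reachable.trans (ih ⟨y, hyA⟩ (by change T.dist r y = n; omega))
    have : Nonempty A := ⟨⟨r, hrA⟩⟩
    exact ⟨fun x y => (key _ x rfl).trans (key _ y rfl).symm⟩

end Tree

lemma not_isStable_of_card_eq_two {V : Type*} [Finite V] {T : SimpleGraph V} (hT : T.IsTree)
    (hV : Nat.card V = 2) : ¬ IsStable T := by
  intro hst
  obtain ⟨x, y, hxy, huniv⟩ := Nat.card_eq_two_iff.1 hV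
  have hall : ∀ z, z = x ∨ z = y := fun z => by
    simpa using (huniv ▸ Set.mem_univ z : z ∈ ({x, y} : Set V))
  have hadj : T.Adj x y := by
    obtain ⟨z, hxz, -⟩ := exists_adj_dist_add_one_eq hT (r := y) hxy
    rcases hall z with rfl | rfl
    · exact absurd rfl hxz.ne
    · exact hxz
  have hE : T.edgeSet = {s(x, y)} := by
    ext e
    induction e with
    | h a b =>
      rw [mem_edgeSet, Set.mem_singleton_iff, Sym2.eq_iff]
      constructor
      · intro h
        have hne := h.ne
        rcases hall a with rfl | rfl <;> rcases hall b with rfl | rfl <;> simp_all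
      · rintro (⟨rfl, rfl⟩ | ⟨rfl, rfl⟩)
        exacts [hadj, hadj.symm]
  have h1 := hst s(x, y) hadj
  have h2 := superDominatedNumber_subdivide_edgeSet_le T
  have h3 := one_le_superDominatedNumber hadj
  rw [hE, Set.ncard_singleton] at h2
  omega

lemma subsingleton_or_familyU_of_isStable {V : Type u} [Finite V] {T : SimpleGraph V}
    (hT : T.IsTree) (hst : IsStable T) : Subsingleton V ∨ FamilyU T := by
  induction hn : Nat.card V using Nat.strong_induction_on generalizing V with
  | _ n ih =>
  by_cases hV : 3 ≤ Nat.card V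
  · right
    obtain ⟨A, v, c, l, hext, hlc, hlA, hA⟩ := exists_isStarExtension_induce hT hV
    have hl : ∀ a : A, (a : V) ≠ l := fun a ha => hlA (ha ▸ a.2)
    obtain ⟨hstA, hv⟩ := (hext.isStable_iff hA.isAcyclic hlc hl).1 hst
    have hcard : Nat.card A < n := by
      rw [← hn]
      exact Finite.card_subtype_lt (x := l) hlA
    rcases ih _ hcard hA hstA rfl with hsub | hU
    · refine FamilyU.star T (Nat.card V - 1) (by omega) (nonempty_iso_starGraph_iff.2
        ⟨c, ?_, by omega⟩).some
      have hcw : ∀ w, w ≠ c → ∀ x, T.Adj w x ↔ x = c := by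
        intro w hwc x
        by_cases hwA : w ∈ A
        · obtain rfl : v = ⟨w, hwA⟩ := Subsingleton.elim _ _
          have hcw := (hext.center_adj_iff ⟨w, hwA⟩).2 rfl
          constructor
          · intro hwx
            by_contra hxc
            by_cases hxA : x ∈ A
            · exact hwx.ne (congrArg Subtype.val (Subsingleton.elim (⟨w, hwA⟩ : A) ⟨x, hxA⟩))
            · exact hwc ((hext.leaf_adj_iff x hxc (fun a ha => hxA (ha ▸ a.2)) w).1 hwx.symm)
          · rintro rfl
            exact hcw.symm
        · exact hext.leaf_adj_iff w hwc (fun a ha => hwA (ha ▸ a.2)) x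
      ext x y
      rw [starGraph_adj]
      by_cases hxc : x = c
      · subst hxc
        by_cases hyx : y = x
        · simp [hyx]
        · rw [T.adj_comm, hcw y hyx]
          simp [Ne.symm hyx]
      · rw [hcw x hxc]
        grind
    · obtain ⟨m, hm, ⟨e⟩⟩ := hext.nonempty_iso hlc hl
      exact FamilyU.attach _ T hU v hv m hm e
  · by_cases hV2 : Nat.card V = 2
    · exact absurd hst (not_isStable_of_card_eq_two hT hV2)
    · exact .inl (Finite.card_le_one_iff_subsingleton.1 (by omega))

/-! ### The subdivision number -/

section SubdivisionNumber

variable {V : Type*} [Finite V] {G : SimpleGraph V}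

lemma superDomSubdivisionNumber_eq_iff {k : ℕ} (hk : k ≠ 0) :
    superDomSubdivisionNumber G = k ↔
      (∃ F ⊆ G.edgeSet, F.ncard = k ∧
        superDominatedNumber (subdivide G F) < superDominatedNumber G + k) ∧
      ∀ F ⊆ G.edgeSet, F.ncard < k →
        superDominatedNumber G + F.ncard ≤ superDominatedNumber (subdivide G F) := by
  have hset : {j : ℕ | ∃ F : Set (Sym2 V), F ⊆ G.edgeSet ∧ F.ncard = j ∧
      superDominationNumber G < superDominationNumber (subdivide G F)} =
      {j | ∃ F ⊆ G.edgeSet, F.ncard = j ∧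
        superDominatedNumber (subdivide G F) < superDominatedNumber G + j} := by
    ext j
    refine exists_congr fun F => and_congr_right fun _ => and_congr_right fun h => ?_
    rw [superDominationNumber_lt_subdivide_iff, h]
  rw [superDomSubdivisionNumber, hset]
  constructor
  · rintro rfl
    refine ⟨Nat.sInf_mem (Nat.nonempty_of_pos_sInf (Nat.pos_of_ne_zero hk)), fun F hF hlt => ?_⟩
    by_contra! hcon
    exact Nat.notMem_of_lt_sInf hlt ⟨F, hF, rfl, hcon⟩
  · rintro ⟨hmem, hlt⟩
    refine le_antisymm (Nat.sInf_le hmem) (le_csInf ⟨k, hmem⟩ ?_)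
    rintro _ ⟨F, hF, rfl, hcon⟩
    by_contra! h
    exact absurd (hlt F hF h) (by omega)

lemma superDominatedNumber_le_subdivide_of_ncard_lt_one {F : Set (Sym2 V)} (hF : F.ncard < 1) :
    superDominatedNumber G + F.ncard ≤ superDominatedNumber (subdivide G F) := by
  obtain rfl := (Set.ncard_eq_zero (Set.toFinite F)).1 (by omega)
  simpa using superDominatedNumber_le_subdivide_empty G

lemma isClass1_iff_not_isStable : IsClass1 G ↔ ¬ IsStable G := by
  rw [IsClass1, superDomSubdivisionNumber_eq_iff one_ne_zero, and_iff_left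
    fun F _ hF => superDominatedNumber_le_subdivide_of_ncard_lt_one hF, IsStable]
  push Not
  constructor
  · rintro ⟨F, hF, hF1, hlt⟩
    obtain ⟨e, rfl⟩ := Set.ncard_eq_one.1 hF1
    exact ⟨e, hF rfl, hlt⟩
  · rintro ⟨e, he, hlt⟩
    exact ⟨{e}, by simpa using he, Set.ncard_singleton e, hlt⟩

lemma isClass2_of_isStable (hst : IsStable G) (h : ∃ F ⊆ G.edgeSet, F.ncard = 2 ∧
    superDominatedNumber (subdivide G F) < superDominatedNumber G + 2) : IsClass2 G := by
  refine (superDomSubdivisionNumber_eq_iff two_ne_zero).2 ⟨h, fun F hF hlt => ?_⟩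
  by_cases hF1 : F.ncard = 1
  · obtain ⟨e, rfl⟩ := Set.ncard_eq_one.1 hF1
    rw [hF1]
    exact hst e (hF rfl)
  · exact superDominatedNumber_le_subdivide_of_ncard_lt_one (by omega)

lemma superDomSubdivisionNumber_starGraph [Nontrivial V] (a : V) :
    superDomSubdivisionNumber (starGraph a) + 1 = Nat.card V := by
  have hE := ncard_edgeSet_starGraph a
  have hV := Finite.one_lt_card (α := V)
  have h1 := superDominatedNumber_starGraph a
  rw [(superDomSubdivisionNumber_eq_iff (by omega)).2 ⟨⟨_, subset_rfl, rfl, ?_⟩, ?_⟩, hE]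
  · have := superDominatedNumber_subdivide_edgeSet_le (starGraph a)
    omega
  · intro F hF hlt
    rw [h1, add_comm]
    exact le_superDominatedNumber_subdivide_starGraph a
      (hF.ssubset_of_ne fun h => by rw [h] at hlt; omega)

end SubdivisionNumber

end SuperDom

theorem theorem3p5 {V : Type u} [Finite V] [Nontrivial V] (T : SimpleGraph V) (hT : T.IsTree) :
    (SuperDom.IsClass1 T ↔ ¬ SuperDom.FamilyU T) ∧
    ((¬ ∃ m : ℕ, 3 ≤ m ∧ Nonempty (T ≃g SimpleGraph.starGraph (0 : Fin (m + 1)))) →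
      (SuperDom.IsClass1 T ∨ SuperDom.IsClass2 T) ∧
      (SuperDom.IsClass2 T ↔ SuperDom.FamilyU T)) ∧
    (∀ m : ℕ, 3 ≤ m → Nonempty (T ≃g SimpleGraph.starGraph (0 : Fin (m + 1))) →
      SuperDom.superDomSubdivisionNumber T = m) := by
  have hU : SuperDom.FamilyU T ↔ SuperDom.IsStable T :=
    ⟨fun h => h.isStable hT.isAcyclic, fun h =>
      (SuperDom.subsingleton_or_familyU_of_isStable hT h).resolve_left (not_subsingleton V)⟩
  have h1 : SuperDom.IsClass1 T ↔ ¬ SuperDom.FamilyU T := by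
    rw [SuperDom.isClass1_iff_not_isStable, hU]
  refine ⟨h1, fun hstar => ?_, fun m _ he => ?_⟩
  · have h2 : SuperDom.FamilyU T → SuperDom.IsClass2 T := fun h =>
      SuperDom.isClass2_of_isStable (hU.1 h) <| (h.exists_two_edges hT.isAcyclic).resolve_left
        fun ⟨a, ha, hV⟩ => hstar ⟨Nat.card V - 1, by omega,
          SuperDom.nonempty_iso_starGraph_iff.2 ⟨a, ha, by omega⟩⟩
    refine ⟨?_, fun hc2 => ?_, h2⟩
    · by_cases h : SuperDom.FamilyU T
      · exact .inr (h2 h)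
      · exact .inl (h1.2 h)
    · by_contra h
      have hc1 := h1.2 h
      rw [SuperDom.IsClass1] at hc1
      rw [SuperDom.IsClass2] at hc2
      omega
  · obtain ⟨a, rfl, hV⟩ := SuperDom.nonempty_iso_starGraph_iff.1 he
    have := SuperDom.superDomSubdivisionNumber_starGraph a
    omega
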